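/- Throughout, $\mathcal F_{op}$ denotes the set of functions $f\colon(0,\infty)\to(0,\infty)$ that are operator monotone (for matrices of every order, $0<A\le B$ implies $f(A)\le f(B)$) and satisfy $f(t)=tf(t^{-1})$ for all $t>0$ and $f(1)=1$. Such an $f$ is called non-regular if $f(0):=\lim_{t\to0^+}f(t)=0$. For a non-regular $f\in\mathcal F_{op}$ put $c(x,y)=\dfrac1{y\,f(xy^{-1})}$ for $x,y>0$. For a positive definite $n\times n$ density matrix $\rho$ let $L_\rho,R_\rho$ be the commuting operators of left and right multiplication by $\rho$ on complex $n\times n$ matrices. Set $$K^c_\rho(A,B)=\operatorname{Tr}A^*c(L_\rho,R_\rho)B .$$ The (unbounded) metric adjusted skew information of $f$ is $$I^c_\rho(A)=K^c_\rho\big(i[\rho,A],i[\rho,A]\big).$$ **Theorem.** Let $1<p\le2$, and let $f_p(1)=1$ and $$f_p(t)=p(1-p)\frac{(t-1)^2}{(t^p-1)(t^{1-p}-1)}\qquad(t>0,\ t\ne1).$$ 1. $f_p\in\mathcal F_{op}$, and $f_p$ is non-regular, that is $\lim_{t\to0^+}f_p(t)=0$. 2. Let $c$ be the function associated with $f_p$,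 and let $\rho$ be a positive definite $n\times n$ density matrix. For every Hermitian $n\times n$ matrix $A$, the metric adjusted skew information of $f_p$ is the Jenčová–Ruskai extension of the Wigner–Yanase–Dyson skew information: $$I^c_\rho(A)=\frac{-1}{p(1-p)}\operatorname{Tr}\,[\rho^p,A]\cdot[\rho^{1-p},A].$$ More generally, for every complex $n\times n$ matrix $A$, $$I^c_\rho(A)=\frac{-1}{p(1-p)}\operatorname{Tr}\,[\rho^p,A^*]\cdot[\rho^{1-p},A].$$ 3. For every complex $n\times n$ matrix $A$, $I^c_\rho(A)$ is real and non-negative, and $\rho\mapsto I^c_\rho(A)$ is convex on the manifold of positive definite $n\times n$ density matrices. In particular, for Hermitian $A$, the Jenčová–Ruskai extension is real, non-negative and convex in $\rho$. 4. The extension is unbounded: for every $n\ge2$ there is a Hermitian $n\times n$ matrix $A$ for which $\rho\mapsto\frac{-1}{p(1-p)}\operatorname{Tr}\,[\rho^p,A]\cdot[\rho^{1-p},A]$ is not bounded above on the positive definite density matrices. -/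

import Mathlib

open Filter Topology
open scoped ComplexOrder

noncomputable section

/-- `f : (0, ∞) → ℝ` is operator monotone: for matrices of every order `n`,
`0 < A ≤ B` implies `f(A) ≤ f(B)` (Loewner order, functional calculus). Only the values of `f` on
`(0, ∞)` matter, since positive definite matrices have positive spectrum. -/
def IsOperatorMonotone (f : ℝ → ℝ) : Prop :=
  ∀ (n : ℕ) (A B : Matrix (Fin n) (Fin n) ℂ), A.PosDef → B.PosDef →
    (B - A).PosSemidef → (cfc f B - cfc f A).PosSemidef

/-- The class `F_op`; a function on `(0, ∞)` is represented by a function on `ℝ` whose values outside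
`(0, ∞)` are irrelevant. -/
structure IsFop (f : ℝ → ℝ) : Prop where
  pos : ∀ t : ℝ, 0 < t → 0 < f t
  operatorMonotone : IsOperatorMonotone f
  symmetric : ∀ t : ℝ, 0 < t → f t = t * f t⁻¹
  map_one : f 1 = 1

/-- `f` is non-regular: its continuous extension to `[0, ∞)` vanishes at `0`. -/
def IsNonRegular (f : ℝ → ℝ) : Prop := Tendsto f (𝓝[>] 0) (𝓝 0)

/-- The Morozova-Chentsov function of `f`. -/
def morozovaChentsov (f : ℝ → ℝ) (x y : ℝ) : ℝ := 1 / (y * f (x * y⁻¹))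

/-- The spectral projection of the Hermitian matrix `ρ` belonging to `x`. -/
def specProj {n : ℕ} (ρ : Matrix (Fin n) (Fin n) ℂ) (x : ℝ) : Matrix (Fin n) (Fin n) ℂ :=
  cfc (fun t : ℝ => if t = x then (1 : ℝ) else 0) ρ

/-- The operator `c(L_ρ, R_ρ)` on matrices, for Hermitian `ρ`: the joint functional calculus of the
commuting operators `L_ρ X = ρ X` and `R_ρ X = X ρ`. Their joint spectral projections are
`X ↦ P_x X P_y`, where `x, y` run over the spectrum of `ρ`. -/
def leftRightCalculus {n : ℕ} (c : ℝ → ℝ → ℝ) (ρ X : Matrix (Fin n) (Fin n) ℂ) :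
    Matrix (Fin n) (Fin n) ℂ :=
  ∑ x ∈ (Matrix.finite_real_spectrum (A := ρ)).toFinset,
    ∑ y ∈ (Matrix.finite_real_spectrum (A := ρ)).toFinset,
      (c x y : ℂ) • (specProj ρ x * X * specProj ρ y)

/-- The form `K_ρ^c(A, B) = Tr A^* c(L_ρ, R_ρ) B`. -/
def monotoneMetric {n : ℕ} (c : ℝ → ℝ → ℝ) (ρ A B : Matrix (Fin n) (Fin n) ℂ) : ℂ :=
  (A.conjTranspose * leftRightCalculus c ρ B).trace

/-- The (unbounded) metric adjusted skew information
`I_ρ^c(A) = K_ρ^c(i[ρ, A], i[ρ, A])` of a non-regular function `f` with Morozova-Chentsov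
function `c`. -/
def unboundedSkewInfo {n : ℕ} (f : ℝ → ℝ) (ρ A : Matrix (Fin n) (Fin n) ℂ) : ℂ :=
  monotoneMetric (morozovaChentsov f) ρ (Complex.I • ⁅ρ, A⁆) (Complex.I • ⁅ρ, A⁆)

/-- The manifold of states: positive definite density matrices. -/
def stateManifold (n : ℕ) : Set (Matrix (Fin n) (Fin n) ℂ) :=
  {ρ | ρ.PosDef ∧ ρ.trace = 1}

/-- The function `f_p`. -/
def wydFunction (p t : ℝ) : ℝ :=
  if t = 1 then 1 else p * (1 - p) * ((t - 1) ^ 2 / ((t ^ p - 1) * (t ^ (1 - p) - 1)))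

/-- The real power `ρ ^ s` of a positive definite matrix. -/
def matrixPow {n : ℕ} (ρ : Matrix (Fin n) (Fin n) ℂ) (s : ℝ) : Matrix (Fin n) (Fin n) ℂ :=
  cfc (fun x : ℝ => x ^ s) ρ

/-- The Jenčová–Ruskai extension of the Wigner-Yanase-Dyson skew information,
`-1/(p(1-p)) Tr [ρ^p, A] [ρ^(1-p), A]`. -/
def jencovaRuskai {n : ℕ} (p : ℝ) (ρ A : Matrix (Fin n) (Fin n) ℂ) : ℂ :=
  ((-1 / (p * (1 - p)) : ℝ) : ℂ) * (⁅matrixPow ρ p, A⁆ * ⁅matrixPow ρ (1 - p), A⁆).trace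

end

open MeasureTheory Set
open scoped Matrix ComplexConjugate

/-! Everything rests on one formula, `exists_measure_wydFunction_inv`: `1 / f_p` is an integral of
`1 / (t + r) + 1 / (1 + r t)` over `r ≥ 0` against a finite positive measure. Each of these
functions reverses the Loewner order, hence so does `1 / f_p`, and a final inversion makes `f_p`
operator monotone.

By homogeneity the Morozova-Chentsov function is the same mixture of the kernels `1 / (x + r y) + 1
/ (y + r x)`. The skew information of a kernel `1 / (a x + b y)` is a maximum of functionals linear
in `ρ`, hence convex (`convexOn_skewInfo_affine`), and integration over `r` preserves convexity.

The trace formula is checked entrywise in an eigenbasis of `ρ`: the commutators contribute `(x - y)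
^ 2`, which cancels the square in `f_p`. Unboundedness comes from diagonal states with one
eigenvalue tending to `0`, where its power `1 - p < 0` blows up. -/

/-! ### Integrals of `r ^ (-q)` against powers of `1 / (1 + r)`. -/

lemma integrableOn_rpow_neg_div_one_add {q : ℝ} (hq0 : 0 < q) (hq1 : q < 1) :
    IntegrableOn (fun r : ℝ => r ^ (-q) / (1 + r)) (Ioi 0) := by
  have hmeas : Measurable fun r : ℝ => r ^ (-q) / (1 + r) := by fun_prop
  rw [← Ioc_union_Ioi_eq_Ioi (zero_le_one' ℝ)]
  refine IntegrableOn.union ?_ ?_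
  · have h := (intervalIntegral.intervalIntegrable_rpow' (a := 0) (b := 1) (r := -q)
      (by linarith)).1
    refine Integrable.mono' h hmeas.aestronglyMeasurable ?_
    filter_upwards [ae_restrict_mem measurableSet_Ioc] with r hr
    have h0 : 0 ≤ r ^ (-q) := Real.rpow_nonneg hr.1.le _
    rw [Real.norm_of_nonneg (div_nonneg h0 (by linarith [hr.1]))]
    exact div_le_self h0 (by linarith [hr.1])
  · have h := integrableOn_Ioi_rpow_of_lt (a := -q - 1) (by linarith) one_pos
    refine Integrable.mono' h hmeas.aestronglyMeasurable ?_
    filter_upwards [ae_restrict_mem measurableSet_Ioi] with r hr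
    have hr0 : 0 < r := lt_trans one_pos hr
    have h0 : 0 ≤ r ^ (-q) := Real.rpow_nonneg hr0.le _
    rw [Real.norm_of_nonneg (div_nonneg h0 (by linarith)), Real.rpow_sub_one hr0.ne']
    exact div_le_div_of_nonneg_left h0 hr0 (by linarith)

lemma integrableOn_rpow_neg_div_add {q t : ℝ} (hq0 : 0 < q) (hq1 : q < 1) (ht : 0 < t) :
    IntegrableOn (fun r : ℝ => r ^ (-q) / (t + r)) (Ioi 0) := by
  refine Integrable.mono' ((integrableOn_rpow_neg_div_one_add hq0 hq1).const_mul (1 / t + 1))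
    (Measurable.aestronglyMeasurable (by fun_prop)) ?_
  filter_upwards [ae_restrict_mem measurableSet_Ioi] with r hr
  have hr0 : 0 < r := hr
  have h0 : 0 ≤ r ^ (-q) := Real.rpow_nonneg hr0.le _
  rw [Real.norm_of_nonneg (div_nonneg h0 (by linarith)), ← mul_div_assoc,
    div_le_div_iff₀ (by linarith) (by linarith)]
  have : 1 + r ≤ (1 / t + 1) * (t + r) := by
    have : (1 / t + 1) * (t + r) = 1 + r + (r / t + t) := by field_simp; ring
    rw [this]
    have : 0 < r / t + t := by positivity
    linarith
  calc r ^ (-q) * (1 + r) ≤ r ^ (-q) * ((1 / t + 1) * (t + r)) :=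
        mul_le_mul_of_nonneg_left this h0
    _ = _ := by ring

lemma integrableOn_rpow_neg_div_one_add_pow {q : ℝ} (hq0 : 0 < q) (hq1 : q < 1) (k : ℕ) :
    IntegrableOn (fun r : ℝ => r ^ (-q) / (1 + r) ^ (k + 1)) (Ioi 0) := by
  refine Integrable.mono' (integrableOn_rpow_neg_div_one_add hq0 hq1)
    (Measurable.aestronglyMeasurable (by fun_prop)) ?_
  filter_upwards [ae_restrict_mem measurableSet_Ioi] with r hr
  have hr0 : 0 < r := hr
  have h0 : 0 ≤ r ^ (-q) := Real.rpow_nonneg hr0.le _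
  rw [Real.norm_of_nonneg (div_nonneg h0 (by positivity))]
  refine div_le_div_of_nonneg_left h0 (by linarith) ?_
  exact le_self_pow₀ (by linarith) (by omega)

/-- Substitute `r ↦ t r`. The constant `∫ r ^ (-q) / (1 + r)` is never evaluated; only its
positivity matters. -/
lemma integral_rpow_neg_div_add {q t : ℝ} (ht : 0 < t) :
    ∫ r in Ioi (0 : ℝ), r ^ (-q) / (t + r) =
      t ^ (-q) * ∫ r in Ioi (0 : ℝ), r ^ (-q) / (1 + r) := by
  have h := integral_comp_mul_left_Ioi (fun r : ℝ => r ^ (-q) / (t + r)) 0 ht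
  rw [mul_zero, smul_eq_mul, eq_inv_mul_iff_mul_eq₀ ht.ne'] at h
  rw [← h, ← integral_const_mul, ← integral_const_mul]
  refine setIntegral_congr_fun measurableSet_Ioi fun r hr => ?_
  have hr0 : 0 < r := hr
  simp only [Real.mul_rpow ht.le hr0.le]
  field_simp

lemma integral_rpow_neg_div_one_add_pos {q : ℝ} (hq0 : 0 < q) (hq1 : q < 1) :
    0 < ∫ r in Ioi (0 : ℝ), r ^ (-q) / (1 + r) := by
  rw [setIntegral_pos_iff_support_of_nonneg_ae]
  · have : Ioi (0 : ℝ) ⊆ Function.support (fun r : ℝ => r ^ (-q) / (1 + r)) := fun r hr => by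
      have hr0 : 0 < r := hr
      have : 0 < r ^ (-q) := Real.rpow_pos_of_pos hr0 _
      simp only [Function.mem_support]
      positivity
    rw [inter_eq_right.2 this]
    simp
  · filter_upwards [ae_restrict_mem measurableSet_Ioi] with r hr
    have hr0 : 0 < r := hr
    simp only [Pi.zero_apply]
    positivity
  · exact integrableOn_rpow_neg_div_one_add hq0 hq1

/-- The difference of the two integrands is the derivative of `r ^ (1 - q) / (1 + r) ^ (k + 1)`,
which vanishes at `0` since `q < 1` and at infinity since `0 < q`. -/
lemma integral_rpow_neg_div_one_add_pow_succ {q : ℝ} (hq0 : 0 < q) (hq1 : q < 1) (k : ℕ) :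
    (k + 1 : ℝ) * ∫ r in Ioi (0 : ℝ), r ^ (-q) / (1 + r) ^ (k + 2) =
      (k + q) * ∫ r in Ioi (0 : ℝ), r ^ (-q) / (1 + r) ^ (k + 1) := by
  have hi1 := (integrableOn_rpow_neg_div_one_add_pow hq0 hq1 k).const_mul (k + q)
  have hi2 := (integrableOn_rpow_neg_div_one_add_pow hq0 hq1 (k + 1)).const_mul (k + 1 : ℝ)
  have key : ∫ r in Ioi (0 : ℝ), ((k + 1 : ℝ) * (r ^ (-q) / (1 + r) ^ (k + 2)) -
      (k + q) * (r ^ (-q) / (1 + r) ^ (k + 1))) = 0 - (0 : ℝ) ^ (1 - q) / (1 + 0) ^ (k + 1) := by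
    refine integral_Ioi_of_hasDerivAt_of_tendsto (f := fun r => r ^ (1 - q) / (1 + r) ^ (k + 1))
      ?_ ?_ (hi2.sub hi1) ?_
    · refine ContinuousAt.continuousWithinAt (ContinuousAt.div ?_ (by fun_prop) (by simp))
      exact Real.continuousAt_rpow_const _ _ (Or.inr (by linarith))
    · intro r hr
      have hr0 : 0 < r := hr
      have h1 := Real.hasDerivAt_rpow_const (x := r) (p := 1 - q) (Or.inl hr0.ne')
      have h2 := ((hasDerivAt_id r).const_add 1).pow (k + 1)
      have hne : (1 + r) ^ (k + 1) ≠ 0 := by positivity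
      refine (h1.div h2 hne).congr_deriv ?_
      have e1 : (1 - q - 1) = -q := by ring
      have e2 : r ^ (1 - q) = r * r ^ (-q) := by
        rw [← e1, Real.rpow_sub_one hr0.ne']; field_simp
      simp only [e1, e2, id, Nat.add_sub_cancel, mul_one, Pi.pow_apply, Nat.cast_add, Nat.cast_one]
      have : (1 + r) ≠ 0 := by positivity
      field_simp
      ring
    · have h := tendsto_rpow_neg_atTop hq0
      refine tendsto_of_tendsto_of_tendsto_of_le_of_le' tendsto_const_nhds h ?_ ?_
      · filter_upwards [eventually_gt_atTop 0] with r hr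
        positivity
      · filter_upwards [eventually_gt_atTop 0] with r hr
        have e2 : r ^ (1 - q) = r * r ^ (-q) := by
          have e1 : (1 - q - 1) = -q := by ring
          rw [← e1, Real.rpow_sub_one hr.ne']; field_simp
        rw [e2, div_le_iff₀ (by positivity), mul_comm]
        refine mul_le_mul_of_nonneg_left ?_ (by positivity)
        exact (by linarith : r ≤ 1 + r).trans (le_self_pow₀ (by linarith) (by omega))
  rw [integral_sub hi2 hi1, integral_const_mul, integral_const_mul,
    Real.zero_rpow (by linarith), zero_div, sub_zero] at key
  exact sub_eq_zero.1 key

/-- Partial fractions in `r`: the simple poles are evaluated by scaling, the double pole by the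
recursion at `k = 0`. -/
lemma integral_rpow_neg_div_one_add_sq_mul {q t : ℝ} (hq0 : 0 < q) (hq1 : q < 1) (ht : 0 < t)
    (ht1 : t ≠ 1) :
    ∫ r in Ioi (0 : ℝ), r ^ (-q) / (1 + r) ^ 2 * (1 / (t + r)) =
      (∫ r in Ioi (0 : ℝ), r ^ (-q) / (1 + r)) * (t ^ (-q) - 1 + q * (t - 1)) / (t - 1) ^ 2 := by
  have h1 := integrableOn_rpow_neg_div_one_add hq0 hq1
  have h2 := integrableOn_rpow_neg_div_one_add_pow hq0 hq1 1
  have ht' := integrableOn_rpow_neg_div_add hq0 hq1 ht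
  have hsub : IntegrableOn (fun r : ℝ => r ^ (-q) / (t + r) - r ^ (-q) / (1 + r)) (Ioi 0) :=
    ht'.sub h1
  have hd : t - 1 ≠ 0 := sub_ne_zero.2 ht1
  have e : ∀ r ∈ Ioi (0 : ℝ), r ^ (-q) / (1 + r) ^ 2 * (1 / (t + r)) =
      ((t - 1) ^ 2)⁻¹ * (r ^ (-q) / (t + r) - r ^ (-q) / (1 + r) +
        (t - 1) * (r ^ (-q) / (1 + r) ^ (1 + 1))) := fun r hr => by
    have hr0 : 0 < r := hr
    have : (1 + r) ≠ 0 := by positivity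
    have : (t + r) ≠ 0 := by positivity
    field_simp
    ring
  have hJ := integral_rpow_neg_div_one_add_pow_succ hq0 hq1 0
  simp only [Nat.cast_zero, zero_add, one_mul, pow_one] at hJ
  rw [setIntegral_congr_fun measurableSet_Ioi e, integral_const_mul,
    integral_add hsub (h2.const_mul _), integral_sub ht' h1, integral_const_mul,
    integral_rpow_neg_div_add ht, one_add_one_eq_two, hJ]
  field_simp

/-! ### The integral representation of `1 / f_p`. -/

lemma integrable_kernel {μ : Measure ℝ} [IsFiniteMeasure μ] (hμ : ∀ᵐ r ∂μ, 0 ≤ r) {x y : ℝ}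
    (hx : 0 < x) (hy : 0 < y) : Integrable (fun r => 1 / (x + r * y) + 1 / (y + r * x)) μ := by
  refine Integrable.mono' (integrable_const (1 / x + 1 / y))
    (Measurable.aestronglyMeasurable (by fun_prop)) ?_
  filter_upwards [hμ] with r hr
  rw [Real.norm_of_nonneg (by positivity)]
  exact add_le_add (one_div_le_one_div_of_le hx (by nlinarith [mul_nonneg hr hy.le]))
    (one_div_le_one_div_of_le hy (by nlinarith [mul_nonneg hr hx.le]))

lemma wydFunction_inv {p t : ℝ} (ht1 : t ≠ 1) :
    (wydFunction p t)⁻¹ =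
      (t ^ p - 1) * (t ^ (1 - p) - 1) / (p * (1 - p) * (t - 1) ^ 2) := by
  rw [wydFunction, if_neg ht1, mul_inv, inv_div]
  simp only [div_eq_mul_inv, mul_inv]
  ring

/-- The reciprocal of `f_p` is a mixture of the functions `t ↦ 1 / (t + r) + 1 / (1 + r t)`. -/
theorem exists_measure_wydFunction_inv {p : ℝ} (hp1 : 1 < p) (hp2 : p ≤ 2) :
    ∃ μ : Measure ℝ, IsFiniteMeasure μ ∧ (∀ᵐ r ∂μ, 0 ≤ r) ∧
      ∀ t : ℝ, 0 < t → (wydFunction p t)⁻¹ = ∫ r, (1 / (t + r) + 1 / (1 + r * t)) ∂μ := by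
  rcases hp2.eq_or_lt with rfl | hp2
  -- At `p = 2` the density used below would be non-integrable at `0`; the measure is instead an
  -- atom there, because `1 / f_2 = (1 / t + 1) / 2`.
  · refine ⟨(2⁻¹ : NNReal) • Measure.dirac 0, inferInstance, ?_, fun t ht => ?_⟩
    · exact Measure.ae_smul_measure ((ae_dirac_iff measurableSet_Ici).2 le_rfl) _
    · rw [integral_smul_nnreal_measure, integral_dirac]
      by_cases ht1 : t = 1
      · subst ht1
        simp [wydFunction, NNReal.smul_def]
        norm_num
      · have hd : t - 1 ≠ 0 := sub_ne_zero.2 ht1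
        rw [wydFunction_inv ht1, show (1 - 2 : ℝ) = -1 by norm_num, Real.rpow_neg_one,
          Real.rpow_two]
        simp only [NNReal.smul_def, NNReal.coe_inv, NNReal.coe_ofNat, smul_eq_mul]
        field_simp
        ring
  · set q := p - 1 with hq
    have hq0 : 0 < q := by linarith
    have hq1 : q < 1 := by linarith
    set J := ∫ r in Ioi (0 : ℝ), r ^ (-q) / (1 + r) with hJdef
    have hJ : 0 < J := integral_rpow_neg_div_one_add_pos hq0 hq1
    -- Normalisation forced by `f_p 1 = 1`: two steps of the recursion give `∫ r ^ (-q) / (1 + r) ^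
    -- 3 = p q J / 2`, and this integral is counted twice at `t = 1`.
    set C := (p * q * J)⁻¹ with hC
    have hC0 : 0 < C := by positivity
    set w : ℝ → ℝ := fun r => C * (r ^ (-q) / (1 + r) ^ 2) with hw
    have hwi : IntegrableOn w (Ioi 0) :=
      (integrableOn_rpow_neg_div_one_add_pow hq0 hq1 1).const_mul C
    have hwm : Measurable w := by fun_prop
    have hpos : ∀ᵐ r ∂(volume.restrict (Ioi (0 : ℝ))), 0 < r := ae_restrict_mem measurableSet_Ioi
    refine ⟨(volume.restrict (Ioi 0)).withDensity fun r => ENNReal.ofReal (w r), ?_, ?_, ?_⟩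
    · exact isFiniteMeasure_withDensity_ofReal hwi.2
    · exact (withDensity_absolutelyContinuous _ _).ae_le (hpos.mono fun r hr => hr.le)
    intro t ht
    rw [integral_withDensity_eq_integral_toReal_smul (by fun_prop)
      (Eventually.of_forall fun r => ENNReal.ofReal_lt_top)]
    -- Since `1 / (1 + r t) = t⁻¹ / (t⁻¹ + r)`, both terms are instances of a single integral, at
    -- `t` and at `t⁻¹`.
    have e : ∀ r ∈ Ioi (0 : ℝ), (ENNReal.ofReal (w r)).toReal • (1 / (t + r) + 1 / (1 + r * t)) =
        C * (r ^ (-q) / (1 + r) ^ 2 * (1 / (t + r)) +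
          t⁻¹ * (r ^ (-q) / (1 + r) ^ 2 * (1 / (t⁻¹ + r)))) := fun r hr => by
      have hr0 : 0 < r := hr
      rw [ENNReal.toReal_ofReal (by positivity), smul_eq_mul]
      simp only [hw]
      field_simp
    have hi : ∀ s : ℝ, 0 < s →
        IntegrableOn (fun r : ℝ => r ^ (-q) / (1 + r) ^ 2 * (1 / (s + r))) (Ioi 0) := fun s hs => by
      refine Integrable.mono' ((integrableOn_rpow_neg_div_one_add_pow hq0 hq1 1).mul_const (1 / s))
        (Measurable.aestronglyMeasurable (by fun_prop)) ?_
      filter_upwards [hpos] with r hr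
      rw [Real.norm_of_nonneg (by positivity)]
      exact mul_le_mul_of_nonneg_left (one_div_le_one_div_of_le hs (by linarith)) (by positivity)
    rw [setIntegral_congr_fun measurableSet_Ioi e, integral_const_mul,
      integral_add (hi t ht) ((hi t⁻¹ (by positivity)).const_mul _), integral_const_mul]
    by_cases ht1 : t = 1
    · subst ht1
      have e3 : ∫ r in Ioi (0 : ℝ), r ^ (-q) / (1 + r) ^ 2 * (1 / (1 + r)) =
          ∫ r in Ioi (0 : ℝ), r ^ (-q) / (1 + r) ^ 3 := by
        refine setIntegral_congr_fun measurableSet_Ioi fun r hr => ?_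
        have hr0 : 0 < r := hr
        field_simp
      have h2 := integral_rpow_neg_div_one_add_pow_succ hq0 hq1 0
      have h3 := integral_rpow_neg_div_one_add_pow_succ hq0 hq1 1
      norm_num at h2 h3
      rw [← hJdef] at h2
      simp only [inv_one, one_mul, e3, wydFunction, if_true]
      have h3' : ∫ r in Ioi (0 : ℝ), r ^ (-q) / (1 + r) ^ 3 = p * q * J / 2 := by
        rw [h2] at h3
        rw [show p = 1 + q by ring]
        linarith
      rw [h3', hC]
      field_simp
      norm_num
    · have ht1' : t⁻¹ ≠ 1 := by simpa using ht1
      have hd : t - 1 ≠ 0 := sub_ne_zero.2 ht1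
      have hd' : 1 - t ≠ 0 := sub_ne_zero.2 (Ne.symm ht1)
      rw [integral_rpow_neg_div_one_add_sq_mul hq0 hq1 ht ht1,
        integral_rpow_neg_div_one_add_sq_mul hq0 hq1 (inv_pos.2 ht) ht1', wydFunction_inv ht1,
        Real.inv_rpow ht.le, ← Real.rpow_neg ht.le, neg_neg, show 1 - p = -q by ring,
        show p = q + 1 by ring, Real.rpow_add_one ht.ne', Real.rpow_neg ht.le, hC,
        ← hJdef, show p = q + 1 by ring]
      have : t ^ q ≠ 0 := (Real.rpow_pos_of_pos ht q).ne'
      have : t⁻¹ - 1 = (1 - t) / t := by field_simp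
      rw [this]
      have h4 : (1 - t) ^ 2 = (t - 1) ^ 2 := by ring
      field_simp
      rw [h4]
      field_simp
      ring

/-! ### Completing the square, eigenbasis coordinates and the Loewner order. -/

/-- The gap is `h⁻¹ ‖v - h y‖ ^ 2`, so equality holds at `y = h⁻¹ v`. This scalar fact underlies
both the antitonicity of inversion and the convexity in `ρ`. -/
lemma two_mul_re_sub_le {h : ℝ} (hh : 0 < h) (y v : ℂ) :
    2 * (conj y * v).re - h * ‖y‖ ^ 2 ≤ h⁻¹ * ‖v‖ ^ 2 := by
  rw [← Complex.normSq_eq_norm_sq, ← Complex.normSq_eq_norm_sq, Complex.normSq_apply,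
    Complex.normSq_apply, Complex.mul_re, Complex.conj_re, Complex.conj_im, ← sub_nonneg]
  have : h⁻¹ * (v.re * v.re + v.im * v.im) -
      (2 * (y.re * v.re - -y.im * v.im) - h * (y.re * y.re + y.im * y.im)) =
      h⁻¹ * ((v.re - h * y.re) ^ 2 + (v.im - h * y.im) ^ 2) := by
    field_simp
    ring
  rw [this]
  positivity

lemma two_mul_re_sub_eq {h : ℝ} (hh : 0 < h) (v : ℂ) :
    2 * (conj ((h⁻¹ : ℝ) * v) * v).re - h * ‖((h⁻¹ : ℝ) * v : ℂ)‖ ^ 2 = h⁻¹ * ‖v‖ ^ 2 := by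
  rw [map_mul, mul_assoc, ← Complex.normSq_eq_conj_mul_self, Complex.conj_ofReal,
    ← Complex.ofReal_mul, Complex.ofReal_re, norm_mul, Complex.norm_real, mul_pow,
    Real.norm_eq_abs, sq_abs, Complex.normSq_eq_norm_sq]
  field_simp
  ring

namespace Matrix.IsHermitian

variable {n : ℕ} {ρ : Matrix (Fin n) (Fin n) ℂ} (hρ : ρ.IsHermitian)

/-- The matrix of an operator in the eigenbasis of the Hermitian matrix `ρ`. -/
noncomputable def eigenCoords : Matrix (Fin n) (Fin n) ℂ →ₗ[ℂ] Matrix (Fin n) (Fin n) ℂ where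
  toFun X := (hρ.eigenvectorUnitary : Matrix (Fin n) (Fin n) ℂ)ᴴ * X * hρ.eigenvectorUnitary
  map_add' X Y := by rw [Matrix.mul_add, Matrix.add_mul]
  map_smul' c X := by simp

lemma eigenCoords_apply (X : Matrix (Fin n) (Fin n) ℂ) : hρ.eigenCoords X =
    (hρ.eigenvectorUnitary : Matrix (Fin n) (Fin n) ℂ)ᴴ * X * hρ.eigenvectorUnitary := rfl

lemma conjTranspose_eigenvectorUnitary_mul_self :
    (hρ.eigenvectorUnitary : Matrix (Fin n) (Fin n) ℂ)ᴴ * hρ.eigenvectorUnitary = 1 :=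
  Unitary.coe_star_mul_self hρ.eigenvectorUnitary

lemma eigenvectorUnitary_mul_conjTranspose_self :
    (hρ.eigenvectorUnitary : Matrix (Fin n) (Fin n) ℂ) *
      (hρ.eigenvectorUnitary : Matrix (Fin n) (Fin n) ℂ)ᴴ = 1 :=
  Unitary.coe_mul_star_self hρ.eigenvectorUnitary

lemma eigenCoords_surjective : Function.Surjective hρ.eigenCoords := fun Z => by
  refine ⟨(hρ.eigenvectorUnitary : Matrix (Fin n) (Fin n) ℂ) * Z *
    (hρ.eigenvectorUnitary : Matrix (Fin n) (Fin n) ℂ)ᴴ, ?_⟩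
  rw [eigenCoords_apply, mul_assoc, mul_assoc, mul_assoc,
    conjTranspose_eigenvectorUnitary_mul_self, mul_one, ← mul_assoc,
    conjTranspose_eigenvectorUnitary_mul_self, one_mul]

lemma eigenCoords_mul (X Y : Matrix (Fin n) (Fin n) ℂ) :
    hρ.eigenCoords (X * Y) = hρ.eigenCoords X * hρ.eigenCoords Y := by
  simp only [eigenCoords_apply]
  conv_lhs => rw [← mul_one X, ← eigenvectorUnitary_mul_conjTranspose_self hρ]
  simp only [mul_assoc]

lemma eigenCoords_conjTranspose (X : Matrix (Fin n) (Fin n) ℂ) :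
    hρ.eigenCoords Xᴴ = (hρ.eigenCoords X)ᴴ := by
  simp only [eigenCoords_apply, conjTranspose_mul, conjTranspose_conjTranspose, mul_assoc]

lemma trace_eigenCoords (X : Matrix (Fin n) (Fin n) ℂ) : (hρ.eigenCoords X).trace = X.trace := by
  rw [eigenCoords_apply, mul_assoc, trace_mul_comm, mul_assoc,
    eigenvectorUnitary_mul_conjTranspose_self, mul_one]

lemma cfc_eq_mul_diagonal_mul (f : ℝ → ℝ) : cfc f ρ =
    (hρ.eigenvectorUnitary : Matrix (Fin n) (Fin n) ℂ) *
      diagonal (fun i => (f (hρ.eigenvalues i) : ℂ)) *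
      (hρ.eigenvectorUnitary : Matrix (Fin n) (Fin n) ℂ)ᴴ := by
  rw [hρ.cfc_eq, IsHermitian.cfc, Unitary.conjStarAlgAut_apply]
  rfl

lemma eigenCoords_cfc (f : ℝ → ℝ) :
    hρ.eigenCoords (cfc f ρ) = diagonal fun i => (f (hρ.eigenvalues i) : ℂ) := by
  rw [cfc_eq_mul_diagonal_mul hρ, eigenCoords_apply, mul_assoc, mul_assoc, mul_assoc,
    conjTranspose_eigenvectorUnitary_mul_self, mul_one, ← mul_assoc,
    conjTranspose_eigenvectorUnitary_mul_self, one_mul]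

lemma eigenCoords_self :
    hρ.eigenCoords ρ = diagonal fun i => (hρ.eigenvalues i : ℂ) := by
  have h := hρ.eigenCoords_cfc id
  rwa [cfc_id ℝ ρ hρ.isSelfAdjoint] at h

lemma trace_conjTranspose_mul (Y X : Matrix (Fin n) (Fin n) ℂ) :
    (Yᴴ * X).trace = ∑ i, ∑ j, conj (hρ.eigenCoords Y i j) * hρ.eigenCoords X i j := by
  rw [← trace_eigenCoords hρ, eigenCoords_mul, eigenCoords_conjTranspose, trace,
    Finset.sum_comm]
  simp [mul_apply]

/-- In the eigenbasis the joint calculus is an entrywise multiplier: at entry `(i, j)` only the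
projections for the `i`-th and `j`-th eigenvalues survive. -/
lemma eigenCoords_leftRightCalculus (c : ℝ → ℝ → ℝ) (X : Matrix (Fin n) (Fin n) ℂ) (i j : Fin n) :
    hρ.eigenCoords (leftRightCalculus c ρ X) i j =
      c (hρ.eigenvalues i) (hρ.eigenvalues j) * hρ.eigenCoords X i j := by
  simp only [leftRightCalculus, map_sum, map_smul, specProj, eigenCoords_mul, eigenCoords_cfc,
    Matrix.sum_apply, smul_apply, mul_diagonal, diagonal_mul, smul_eq_mul]
  rw [Finset.sum_eq_single (hρ.eigenvalues i), Finset.sum_eq_single (hρ.eigenvalues j)]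
  · simp
  · intro y _ hy
    simp [Ne.symm hy]
  · exact fun h => (h (by simpa using hρ.eigenvalues_mem_spectrum_real j)).elim
  · intro x _ hx
    simp [Ne.symm hx]
  · exact fun h => (h (by simpa using hρ.eigenvalues_mem_spectrum_real i)).elim

lemma eigenCoords_lie_cfc (f : ℝ → ℝ) (A : Matrix (Fin n) (Fin n) ℂ) (i j : Fin n) :
    hρ.eigenCoords ⁅cfc f ρ, A⁆ i j =
      ((f (hρ.eigenvalues i) - f (hρ.eigenvalues j) : ℝ) : ℂ) * hρ.eigenCoords A i j := by
  rw [Ring.lie_def, map_sub, eigenCoords_mul, eigenCoords_mul, eigenCoords_cfc, sub_apply,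
    mul_diagonal, diagonal_mul]
  push_cast
  ring

lemma eigenCoords_lie (A : Matrix (Fin n) (Fin n) ℂ) (i j : Fin n) :
    hρ.eigenCoords ⁅ρ, A⁆ i j =
      ((hρ.eigenvalues i - hρ.eigenvalues j : ℝ) : ℂ) * hρ.eigenCoords A i j := by
  have h := hρ.eigenCoords_lie_cfc id A i j
  rwa [cfc_id ℝ ρ hρ.isSelfAdjoint] at h

lemma monotoneMetric_commutator (c : ℝ → ℝ → ℝ) (A : Matrix (Fin n) (Fin n) ℂ) :
    monotoneMetric c ρ (Complex.I • ⁅ρ, A⁆) (Complex.I • ⁅ρ, A⁆) =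
      ((∑ i, ∑ j, c (hρ.eigenvalues i) (hρ.eigenvalues j) *
        ((hρ.eigenvalues i - hρ.eigenvalues j) ^ 2 * ‖hρ.eigenCoords A i j‖ ^ 2) : ℝ) : ℂ) := by
  rw [monotoneMetric, trace_conjTranspose_mul hρ]
  push_cast
  refine Finset.sum_congr rfl fun i _ => Finset.sum_congr rfl fun j _ => ?_
  rw [eigenCoords_leftRightCalculus, map_smul, smul_apply, eigenCoords_lie, ← Complex.conj_mul',
    smul_eq_mul, map_mul, map_mul, Complex.conj_I, Complex.conj_ofReal]
  push_cast
  linear_combination -(c (hρ.eigenvalues i) (hρ.eigenvalues j) : ℂ) *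
    (hρ.eigenvalues i - hρ.eigenvalues j) ^ 2 * (conj (hρ.eigenCoords A i j)) *
    (hρ.eigenCoords A i j) * Complex.I_sq

/-- Because `[f(ρ), A^*] = -[f(ρ), A]^*`, the trace is minus a Hilbert-Schmidt inner product of two
entrywise multiples of `A`. -/
lemma trace_lie_cfc_mul_lie_cfc (f g : ℝ → ℝ) (A : Matrix (Fin n) (Fin n) ℂ) :
    (⁅cfc f ρ, Aᴴ⁆ * ⁅cfc g ρ, A⁆).trace =
      ((-∑ i, ∑ j, (f (hρ.eigenvalues i) - f (hρ.eigenvalues j)) *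
        (g (hρ.eigenvalues i) - g (hρ.eigenvalues j)) * ‖hρ.eigenCoords A i j‖ ^ 2 : ℝ) : ℂ) := by
  have h : ⁅cfc f ρ, Aᴴ⁆ = -(⁅cfc f ρ, A⁆)ᴴ := by
    have hs : (cfc f ρ)ᴴ = cfc f ρ := cfc_predicate f ρ
    rw [Ring.lie_def, Ring.lie_def, conjTranspose_sub, conjTranspose_mul, conjTranspose_mul, hs]
    abel
  rw [h, neg_mul, trace_neg, trace_conjTranspose_mul hρ]
  push_cast
  refine congrArg _ (Finset.sum_congr rfl fun i _ => Finset.sum_congr rfl fun j _ => ?_)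
  rw [eigenCoords_lie_cfc, eigenCoords_lie_cfc, ← Complex.conj_mul', map_mul, Complex.conj_ofReal]
  push_cast
  ring

/-- The quadratic form of `cfc f ρ` in the eigenbasis of `ρ`. -/
lemma star_dotProduct_cfc_mulVec (f : ℝ → ℝ) (v : Fin n → ℂ) :
    star v ⬝ᵥ (cfc f ρ *ᵥ v) = ((∑ i, f (hρ.eigenvalues i) *
      ‖((hρ.eigenvectorUnitary : Matrix (Fin n) (Fin n) ℂ)ᴴ *ᵥ v) i‖ ^ 2 : ℝ) : ℂ) := by
  rw [cfc_eq_mul_diagonal_mul hρ, ← mulVec_mulVec, ← mulVec_mulVec, dotProduct_mulVec,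
    ← conjTranspose_conjTranspose (hρ.eigenvectorUnitary : Matrix (Fin n) (Fin n) ℂ),
    ← star_mulVec, conjTranspose_conjTranspose, dotProduct]
  push_cast
  refine Finset.sum_congr rfl fun i _ => ?_
  rw [mulVec_diagonal, ← Complex.conj_mul', Pi.star_apply]
  simp only [RCLike.star_def]
  ring

lemma star_dotProduct_eq_sum (y v : Fin n → ℂ) :
    star y ⬝ᵥ v = ∑ i, conj (((hρ.eigenvectorUnitary : Matrix (Fin n) (Fin n) ℂ)ᴴ *ᵥ y) i) *
      ((hρ.eigenvectorUnitary : Matrix (Fin n) (Fin n) ℂ)ᴴ *ᵥ v) i := by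
  conv_lhs => rw [← one_mulVec v, ← eigenvectorUnitary_mul_conjTranspose_self hρ]
  rw [← mulVec_mulVec, dotProduct_mulVec,
    ← conjTranspose_conjTranspose (hρ.eigenvectorUnitary : Matrix (Fin n) (Fin n) ℂ),
    ← star_mulVec, conjTranspose_conjTranspose, dotProduct]
  rfl

/-- With the next lemma: the quadratic form of an inverse is a maximum over `y` of expressions in
which the operator itself enters only through `-⟨y, h(ρ) y⟩`. -/
lemma two_mul_re_dotProduct_sub_le {h : ℝ → ℝ} (hh : ∀ i, 0 < h (hρ.eigenvalues i))
    (y v : Fin n → ℂ) :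
    2 * (star y ⬝ᵥ v).re - (star y ⬝ᵥ (cfc h ρ *ᵥ y)).re ≤
      (star v ⬝ᵥ (cfc (fun t => (h t)⁻¹) ρ *ᵥ v)).re := by
  rw [star_dotProduct_cfc_mulVec hρ, star_dotProduct_cfc_mulVec hρ, star_dotProduct_eq_sum hρ,
    Complex.ofReal_re, Complex.ofReal_re, Complex.re_sum, Finset.mul_sum, ← Finset.sum_sub_distrib]
  exact Finset.sum_le_sum fun i _ => two_mul_re_sub_le (hh i) _ _

lemma exists_two_mul_re_dotProduct_sub_eq {h : ℝ → ℝ} (hh : ∀ i, 0 < h (hρ.eigenvalues i))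
    (v : Fin n → ℂ) : ∃ y : Fin n → ℂ,
    2 * (star y ⬝ᵥ v).re - (star y ⬝ᵥ (cfc h ρ *ᵥ y)).re =
      (star v ⬝ᵥ (cfc (fun t => (h t)⁻¹) ρ *ᵥ v)).re := by
  refine ⟨(hρ.eigenvectorUnitary : Matrix (Fin n) (Fin n) ℂ) *ᵥ fun i =>
    (((h (hρ.eigenvalues i))⁻¹ : ℝ) : ℂ) *
      ((hρ.eigenvectorUnitary : Matrix (Fin n) (Fin n) ℂ)ᴴ *ᵥ v) i, ?_⟩
  rw [star_dotProduct_cfc_mulVec hρ, star_dotProduct_cfc_mulVec hρ, star_dotProduct_eq_sum hρ,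
    Complex.ofReal_re, Complex.ofReal_re, Complex.re_sum, Finset.mul_sum, ← Finset.sum_sub_distrib,
    mulVec_mulVec, conjTranspose_eigenvectorUnitary_mul_self, one_mulVec]
  exact Finset.sum_congr rfl fun i _ => two_mul_re_sub_eq (hh i) _

lemma posSemidef_cfc_sub_cfc_iff {A B : Matrix (Fin n) (Fin n) ℂ} (hA : A.IsHermitian)
    (hB : B.IsHermitian) (f g : ℝ → ℝ) : (cfc g B - cfc f A).PosSemidef ↔
      ∀ v, (star v ⬝ᵥ (cfc f A *ᵥ v)).re ≤ (star v ⬝ᵥ (cfc g B *ᵥ v)).re := by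
  have hf : IsSelfAdjoint (cfc f A) := cfc_predicate f A
  have hg : IsSelfAdjoint (cfc g B) := cfc_predicate g B
  rw [posSemidef_iff_dotProduct_mulVec, and_iff_right (hg.sub hf).isHermitian]
  refine forall_congr' fun v => ?_
  rw [sub_mulVec, dotProduct_sub, star_dotProduct_cfc_mulVec hA, star_dotProduct_cfc_mulVec hB,
    sub_nonneg, Complex.real_le_real, Complex.ofReal_re, Complex.ofReal_re]

/-- Inversion reverses the Loewner order. -/
lemma posSemidef_cfc_inv_sub {A B : Matrix (Fin n) (Fin n) ℂ} (hA : A.IsHermitian)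
    (hB : B.IsHermitian) {f g : ℝ → ℝ} (hf : ∀ i, 0 < f (hA.eigenvalues i))
    (hg : ∀ i, 0 < g (hB.eigenvalues i)) (h : (cfc g B - cfc f A).PosSemidef) :
    (cfc (fun t => (f t)⁻¹) A - cfc (fun t => (g t)⁻¹) B).PosSemidef := by
  rw [posSemidef_cfc_sub_cfc_iff hA hB] at h
  rw [posSemidef_cfc_sub_cfc_iff hB hA]
  intro v
  -- The maximiser for `g(B)` serves as a test vector for `f(A)`, so no common eigenbasis is needed.
  obtain ⟨y, hy⟩ := exists_two_mul_re_dotProduct_sub_eq hB hg v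
  have := two_mul_re_dotProduct_sub_le hA hf y v
  linarith [h y]

end Matrix.IsHermitian

/-! ### Operator monotonicity from the integral representation. -/

lemma cfc_const_add_mul {n : ℕ} {A : Matrix (Fin n) (Fin n) ℂ} (hA : A.IsHermitian) (a b : ℝ) :
    cfc (fun t => a + b * t) A = (a : ℂ) • (1 : Matrix (Fin n) (Fin n) ℂ) + (b : ℂ) • A := by
  have hA' : IsSelfAdjoint A := hA
  rw [cfc_const_add a (fun t => b * t) A, cfc_const_mul_id b A, Algebra.algebraMap_eq_smul_one]
  rfl

lemma posSemidef_cfc_one_div_affine_sub {n : ℕ} {A B : Matrix (Fin n) (Fin n) ℂ} (hA : A.PosDef)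
    (hB : B.PosDef) (hAB : (B - A).PosSemidef) {a b : ℝ} (ha : 0 ≤ a) (hb : 0 ≤ b)
    (hab : 0 < a + b) :
    (cfc (fun t => (a + b * t)⁻¹) A - cfc (fun t => (a + b * t)⁻¹) B).PosSemidef := by
  have hpos : ∀ t : ℝ, 0 < t → 0 < a + b * t := fun t ht => by
    rcases ha.eq_or_lt with rfl | ha
    · have : 0 < b := by linarith
      positivity
    · positivity
  refine Matrix.IsHermitian.posSemidef_cfc_inv_sub hA.1 hB.1
    (fun i => hpos _ (hA.eigenvalues_pos i)) (fun i => hpos _ (hB.eigenvalues_pos i)) ?_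
  rw [cfc_const_add_mul hA.1, cfc_const_add_mul hB.1, add_sub_add_left_eq_sub, ← smul_sub]
  exact hAB.smul (by exact_mod_cast hb)

theorem isOperatorMonotone_of_inv_eq_integral {f : ℝ → ℝ} (hf : ∀ t, 0 < t → 0 < f t)
    {μ : Measure ℝ} [IsFiniteMeasure μ] (hμ : ∀ᵐ r ∂μ, 0 ≤ r)
    (hfμ : ∀ t, 0 < t → (f t)⁻¹ = ∫ r, (1 / (t + r) + 1 / (1 + r * t)) ∂μ) :
    IsOperatorMonotone f := by
  intro n A B hA hB hAB
  have hint : ∀ t : ℝ, 0 < t → Integrable (fun r => 1 / (t + r) + 1 / (1 + r * t)) μ :=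
    fun t ht => by simpa using integrable_kernel hμ ht one_pos
  have hquad : ∀ {C : Matrix (Fin n) (Fin n) ℂ}, C.PosDef → ∀ v : Fin n → ℂ,
      Integrable (fun r => (star v ⬝ᵥ (cfc (fun t => 1 / (t + r) + 1 / (1 + r * t)) C *ᵥ v)).re) μ ∧
      (star v ⬝ᵥ (cfc (fun t => (f t)⁻¹) C *ᵥ v)).re =
        ∫ r, (star v ⬝ᵥ (cfc (fun t => 1 / (t + r) + 1 / (1 + r * t)) C *ᵥ v)).re ∂μ := by
    intro C hC v
    simp only [hC.1.star_dotProduct_cfc_mulVec, Complex.ofReal_re]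
    have hi := fun i => (hint _ (hC.eigenvalues_pos i)).mul_const
      (‖((hC.1.eigenvectorUnitary : Matrix (Fin n) (Fin n) ℂ)ᴴ *ᵥ v) i‖ ^ 2)
    refine ⟨integrable_finsetSum _ fun i _ => hi i, ?_⟩
    rw [integral_finsetSum _ fun i _ => hi i]
    refine Finset.sum_congr rfl fun i _ => ?_
    rw [integral_mul_const, hfμ _ (hC.eigenvalues_pos i)]
  have key : (cfc (fun t => (f t)⁻¹) A - cfc (fun t => (f t)⁻¹) B).PosSemidef := by
    rw [Matrix.IsHermitian.posSemidef_cfc_sub_cfc_iff hB.1 hA.1]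
    intro v
    rw [(hquad hA v).2, (hquad hB v).2]
    refine integral_mono_ae (hquad hB v).1 (hquad hA v).1 ?_
    filter_upwards [hμ] with r hr
    -- The two summands of the kernel are `(a + b t)⁻¹` with `(a, b) = (r, 1)` and `(1, r)`.
    have h1 := posSemidef_cfc_one_div_affine_sub hA hB hAB hr zero_le_one (by linarith)
    have h2 := posSemidef_cfc_one_div_affine_sub hA hB hAB zero_le_one hr (by linarith)
    rw [Matrix.IsHermitian.posSemidef_cfc_sub_cfc_iff hB.1 hA.1] at h1 h2
    have h1 := h1 v
    have h2 := h2 v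
    simp only [hA.1.star_dotProduct_cfc_mulVec, hB.1.star_dotProduct_cfc_mulVec,
      Complex.ofReal_re] at h1 h2 ⊢
    simp only [add_mul, Finset.sum_add_distrib, one_div, one_mul, add_comm r] at h1 h2 ⊢
    exact add_le_add h1 h2
  -- A second inversion turns antitonicity of `1 / f` into monotonicity of `f`.
  simpa using Matrix.IsHermitian.posSemidef_cfc_inv_sub hB.1 hA.1 (f := fun t => (f t)⁻¹)
    (g := fun t => (f t)⁻¹)
    (fun i => inv_pos.2 (hf _ (hB.eigenvalues_pos i)))
    (fun i => inv_pos.2 (hf _ (hA.eigenvalues_pos i))) key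

/-! ### Convexity of the skew information. -/

lemma convex_stateManifold (n : ℕ) : Convex ℝ (stateManifold n) := by
  rintro x ⟨hx, hx1⟩ y ⟨hy, hy1⟩ a b ha hb hab
  refine ⟨?_, ?_⟩
  · rcases ha.eq_or_lt with rfl | ha
    · rw [zero_add] at hab
      simpa [hab] using hy
    · exact (hx.smul ha).add_posSemidef (hy.posSemidef.smul hb)
  · rw [Matrix.trace_add, Matrix.trace_smul, Matrix.trace_smul, hx1, hy1, ← add_smul, hab, one_smul]

/-- The functional `2 Re Tr Y^*[ρ, A] - Re Tr Y^*(a ρ Y + b Y ρ)`, linear in `ρ`, whose maximum over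
`Y` is the skew information with kernel `1 / (a x + b y)`. -/
noncomputable def skewVariational {n : ℕ} (a b : ℝ) (A Y ρ : Matrix (Fin n) (Fin n) ℂ) : ℝ :=
  2 * (Yᴴ * ⁅ρ, A⁆).trace.re - (a * (Yᴴ * (ρ * Y)).trace.re + b * (Yᴴ * (Y * ρ)).trace.re)

lemma skewVariational_add_smul {n : ℕ} (a b s t : ℝ) (A Y ρ σ : Matrix (Fin n) (Fin n) ℂ) :
    skewVariational a b A Y (s • ρ + t • σ) =
      s * skewVariational a b A Y ρ + t * skewVariational a b A Y σ := by
  simp only [skewVariational, Ring.lie_def, Matrix.mul_add, Matrix.add_mul, Matrix.mul_sub,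
    Matrix.smul_mul, Matrix.mul_smul, Matrix.trace_add, Matrix.trace_sub, Matrix.trace_smul,
    Complex.add_re, Complex.sub_re, Complex.smul_re, smul_eq_mul]
  ring

lemma skewVariational_eq_sum {n : ℕ} {ρ : Matrix (Fin n) (Fin n) ℂ} (hρ : ρ.IsHermitian) (a b : ℝ)
    (A Y : Matrix (Fin n) (Fin n) ℂ) : skewVariational a b A Y ρ =
      ∑ i, ∑ j, (2 * (conj (hρ.eigenCoords Y i j) *
        (((hρ.eigenvalues i - hρ.eigenvalues j : ℝ) : ℂ) * hρ.eigenCoords A i j)).re -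
        (a * hρ.eigenvalues i + b * hρ.eigenvalues j) * ‖hρ.eigenCoords Y i j‖ ^ 2) := by
  have e : ∀ (x : ℝ) (z : ℂ), x * ‖z‖ ^ 2 = (conj z * ((x : ℂ) * z)).re := fun x z => by
    rw [mul_left_comm, Complex.conj_mul', ← Complex.ofReal_pow, ← Complex.ofReal_mul,
      Complex.ofReal_re]
  simp only [skewVariational, hρ.trace_conjTranspose_mul, hρ.eigenCoords_lie, hρ.eigenCoords_mul,
    hρ.eigenCoords_self, Matrix.mul_diagonal, Matrix.diagonal_mul, Complex.re_sum, Finset.mul_sum,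
    ← Finset.sum_add_distrib, ← Finset.sum_sub_distrib]
  refine Finset.sum_congr rfl fun i _ => Finset.sum_congr rfl fun j _ => ?_
  rw [add_mul, mul_assoc a, mul_assoc b, e, e, mul_comm (hρ.eigenCoords Y i j) (_ : ℂ)]

/-- Complete the square separately in each eigenbasis entry, with weight `a λ_i + b λ_j`. -/
lemma skewVariational_le {n : ℕ} {ρ : Matrix (Fin n) (Fin n) ℂ} (hρ : ρ.PosDef) {a b : ℝ}
    (hab : ∀ x y, 0 < x → 0 < y → 0 < a * x + b * y) (A Y : Matrix (Fin n) (Fin n) ℂ) :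
    skewVariational a b A Y ρ ≤ (monotoneMetric (fun x y => (a * x + b * y)⁻¹) ρ
      (Complex.I • ⁅ρ, A⁆) (Complex.I • ⁅ρ, A⁆)).re := by
  rw [skewVariational_eq_sum hρ.1, hρ.1.monotoneMetric_commutator, Complex.ofReal_re]
  refine Finset.sum_le_sum fun i _ => Finset.sum_le_sum fun j _ => ?_
  refine (two_mul_re_sub_le (hab _ _ (hρ.eigenvalues_pos i) (hρ.eigenvalues_pos j)) _ _).trans_eq ?_
  rw [norm_mul, mul_pow, Complex.norm_real, Real.norm_eq_abs, sq_abs]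

lemma exists_skewVariational_eq {n : ℕ} {ρ : Matrix (Fin n) (Fin n) ℂ} (hρ : ρ.PosDef) {a b : ℝ}
    (hab : ∀ x y, 0 < x → 0 < y → 0 < a * x + b * y) (A : Matrix (Fin n) (Fin n) ℂ) :
    ∃ Y, skewVariational a b A Y ρ = (monotoneMetric (fun x y => (a * x + b * y)⁻¹) ρ
      (Complex.I • ⁅ρ, A⁆) (Complex.I • ⁅ρ, A⁆)).re := by
  -- Entrywise maximiser: the commutator `[ρ, A]` divided by `a λ_i + b λ_j`.
  obtain ⟨Y, hY⟩ := hρ.1.eigenCoords_surjective (Matrix.of fun i j =>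
    (((a * hρ.1.eigenvalues i + b * hρ.1.eigenvalues j)⁻¹ : ℝ) : ℂ) *
      (((hρ.1.eigenvalues i - hρ.1.eigenvalues j : ℝ) : ℂ) * hρ.1.eigenCoords A i j))
  refine ⟨Y, ?_⟩
  rw [skewVariational_eq_sum hρ.1, hρ.1.monotoneMetric_commutator, Complex.ofReal_re, hY]
  refine Finset.sum_congr rfl fun i _ => Finset.sum_congr rfl fun j _ => ?_
  rw [Matrix.of_apply, two_mul_re_sub_eq (hab _ _ (hρ.eigenvalues_pos i) (hρ.eigenvalues_pos j)),
    norm_mul, mul_pow, Complex.norm_real, Real.norm_eq_abs, sq_abs]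

/-- A maximum of linear functionals is convex: the maximiser `Y` of the mixture is a competitor at
both endpoints. -/
lemma convexOn_skewInfo_affine {n : ℕ} {a b : ℝ}
    (hab : ∀ x y, 0 < x → 0 < y → 0 < a * x + b * y) (A : Matrix (Fin n) (Fin n) ℂ) :
    ConvexOn ℝ (stateManifold n) fun ρ => (monotoneMetric (fun x y => (a * x + b * y)⁻¹) ρ
      (Complex.I • ⁅ρ, A⁆) (Complex.I • ⁅ρ, A⁆)).re := by
  refine ⟨convex_stateManifold n, fun ρ hρ σ hσ s t hs ht hst => ?_⟩
  obtain ⟨Y, hY⟩ := exists_skewVariational_eq (convex_stateManifold n hρ hσ hs ht hst).1 hab A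
  simp only [← hY, skewVariational_add_smul, smul_eq_mul]
  exact add_le_add (mul_le_mul_of_nonneg_left (skewVariational_le hρ.1 hab A Y) hs)
    (mul_le_mul_of_nonneg_left (skewVariational_le hσ.1 hab A Y) ht)

lemma morozovaChentsov_eq_integral {f : ℝ → ℝ} {μ : Measure ℝ}
    (hμ : ∀ᵐ r ∂μ, 0 ≤ r)
    (hfμ : ∀ t, 0 < t → (f t)⁻¹ = ∫ r, (1 / (t + r) + 1 / (1 + r * t)) ∂μ) {x y : ℝ}
    (hx : 0 < x) (hy : 0 < y) :
    morozovaChentsov f x y = ∫ r, (1 / (x + r * y) + 1 / (y + r * x)) ∂μ := by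
  rw [morozovaChentsov, one_div, mul_inv, hfμ _ (by positivity), ← integral_const_mul]
  refine integral_congr_ae ?_
  filter_upwards [hμ] with r hr
  field_simp

theorem convexOn_unboundedSkewInfo {f : ℝ → ℝ} {μ : Measure ℝ} [IsFiniteMeasure μ]
    (hμ : ∀ᵐ r ∂μ, 0 ≤ r)
    (hfμ : ∀ t, 0 < t → (f t)⁻¹ = ∫ r, (1 / (t + r) + 1 / (1 + r * t)) ∂μ)
    {n : ℕ} (A : Matrix (Fin n) (Fin n) ℂ) :
    ConvexOn ℝ (stateManifold n) fun ρ => (unboundedSkewInfo f ρ A).re := by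
  set F : ℝ → Matrix (Fin n) (Fin n) ℂ → ℝ := fun r ρ =>
    (monotoneMetric (fun x y => (1 * x + r * y)⁻¹) ρ
      (Complex.I • ⁅ρ, A⁆) (Complex.I • ⁅ρ, A⁆)).re +
    (monotoneMetric (fun x y => (r * x + 1 * y)⁻¹) ρ
      (Complex.I • ⁅ρ, A⁆) (Complex.I • ⁅ρ, A⁆)).re with hF
  have hFconv : ∀ r : ℝ, 0 ≤ r → ConvexOn ℝ (stateManifold n) (F r) := fun r hr =>
    (convexOn_skewInfo_affine (fun x y hx hy => by positivity) A).add
      (convexOn_skewInfo_affine (fun x y hx hy => by positivity) A)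
  -- For fixed `ρ` both sides are finite sums over pairs of eigenvalues, so the integral over `r`
  -- can be exchanged with them.
  have hint : ∀ ρ ∈ stateManifold n, Integrable (fun r => F r ρ) μ ∧
      (unboundedSkewInfo f ρ A).re = ∫ r, F r ρ ∂μ := by
    rintro ρ ⟨hρ, -⟩
    have hi := fun i j => (integrable_kernel hμ (hρ.eigenvalues_pos i)
      (hρ.eigenvalues_pos j)).mul_const
        ((hρ.1.eigenvalues i - hρ.1.eigenvalues j) ^ 2 * ‖hρ.1.eigenCoords A i j‖ ^ 2)
    have e : (fun r => F r ρ) = fun r => ∑ i, ∑ j,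
        (1 / (hρ.1.eigenvalues i + r * hρ.1.eigenvalues j) +
          1 / (hρ.1.eigenvalues j + r * hρ.1.eigenvalues i)) *
        ((hρ.1.eigenvalues i - hρ.1.eigenvalues j) ^ 2 * ‖hρ.1.eigenCoords A i j‖ ^ 2) := by
      funext r
      simp only [hF, hρ.1.monotoneMetric_commutator, Complex.ofReal_re, ← Finset.sum_add_distrib,
        one_div, one_mul, add_mul]
      simp only [add_comm (r * _)]
    rw [e, unboundedSkewInfo, hρ.1.monotoneMetric_commutator, Complex.ofReal_re]
    refine ⟨integrable_finsetSum _ fun i _ => integrable_finsetSum _ fun j _ => hi i j, ?_⟩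
    rw [integral_finsetSum _ fun i _ => integrable_finsetSum _ fun j _ => hi i j]
    refine Finset.sum_congr rfl fun i _ => ?_
    rw [integral_finsetSum _ fun j _ => hi i j]
    refine Finset.sum_congr rfl fun j _ => ?_
    rw [integral_mul_const, morozovaChentsov_eq_integral hμ hfμ (hρ.eigenvalues_pos i)
      (hρ.eigenvalues_pos j)]
  refine ⟨convex_stateManifold n, fun ρ hρ σ hσ s t hs ht hst => ?_⟩
  have hτ := convex_stateManifold n hρ hσ hs ht hst
  simp only [(hint _ hτ).2, (hint _ hρ).2, (hint _ hσ).2, smul_eq_mul]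
  rw [← integral_const_mul, ← integral_const_mul,
    ← integral_add ((hint _ hρ).1.const_mul s) ((hint _ hσ).1.const_mul t)]
  refine integral_mono_ae (hint _ hτ).1
    (((hint _ hρ).1.const_mul s).add ((hint _ hσ).1.const_mul t)) ?_
  filter_upwards [hμ] with r hr
  exact (hFconv r hr).2 hρ hσ hs ht hst

/-! ### Properties of `f_p` and the trace formula. -/

lemma wydFunction_pos {p t : ℝ} (hp1 : 1 < p) (ht : 0 < t) : 0 < wydFunction p t := by
  by_cases ht1 : t = 1
  · simp [wydFunction, ht1]
  rw [← inv_pos, wydFunction_inv ht1]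
  have hd : 0 < (t - 1) ^ 2 := sq_pos_of_ne_zero (sub_ne_zero.2 ht1)
  refine div_pos_of_neg_of_neg ?_ (mul_neg_of_neg_of_pos (by nlinarith) hd)
  rcases lt_or_gt_of_ne ht1 with h | h
  · exact mul_neg_of_neg_of_pos (sub_neg.2 (Real.rpow_lt_one ht.le h (by linarith)))
      (sub_pos.2 (Real.one_lt_rpow_of_pos_of_lt_one_of_neg ht h (by linarith)))
  · exact mul_neg_of_pos_of_neg (sub_pos.2 (Real.one_lt_rpow h (by linarith)))
      (sub_neg.2 (Real.rpow_lt_one_of_one_lt_of_neg h (by linarith)))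

lemma wydFunction_symmetric {p t : ℝ} (ht : 0 < t) :
    wydFunction p t = t * wydFunction p t⁻¹ := by
  by_cases ht1 : t = 1
  · simp [wydFunction, ht1]
  have ht1' : t⁻¹ ≠ 1 := by simpa using ht1
  have e : t = t ^ p * t ^ (1 - p) := by
    rw [← Real.rpow_add ht, add_sub_cancel, Real.rpow_one]
  rw [← inv_inj, mul_inv, wydFunction_inv ht1, wydFunction_inv ht1', Real.inv_rpow ht.le,
    Real.inv_rpow ht.le]
  have h1 : t ^ p ≠ 0 := (Real.rpow_pos_of_pos ht _).ne'
  have h2 : t ^ (1 - p) ≠ 0 := (Real.rpow_pos_of_pos ht _).ne'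
  have e1 : (t ^ p)⁻¹ - 1 = -(t ^ p - 1) / t ^ p := by field_simp; ring
  have e2 : (t ^ (1 - p))⁻¹ - 1 = -(t ^ (1 - p) - 1) / t ^ (1 - p) := by field_simp; ring
  have e3 : (t⁻¹ - 1) ^ 2 = (t - 1) ^ 2 / t ^ 2 := by field_simp; ring
  have e4 : (-(t ^ p - 1) / t ^ p) * (-(t ^ (1 - p) - 1) / t ^ (1 - p)) =
      (t ^ p - 1) * (t ^ (1 - p) - 1) / t := by
    rw [div_mul_div_comm, ← e, neg_mul_neg]
  rw [e1, e2, e3, e4]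
  field_simp

lemma isNonRegular_wydFunction {p : ℝ} (hp1 : 1 < p) : IsNonRegular (wydFunction p) := by
  have h0 : Tendsto (fun t : ℝ => t) (𝓝[>] 0) (𝓝 0) := tendsto_id.mono_left nhdsWithin_le_nhds
  have hp : ∀ s : ℝ, 0 < s → Tendsto (fun t : ℝ => t ^ s) (𝓝[>] 0) (𝓝 0) := fun s hs => by
    have := (Real.continuousAt_rpow_const 0 s (Or.inr hs.le)).tendsto
    rw [Real.zero_rpow hs.ne'] at this
    exact this.mono_left nhdsWithin_le_nhds
  -- Numerator and denominator are multiplied by `t ^ (p - 1)`, which removes the pole of `t ^ (1 -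
  -- p)` at `0`.
  have hlim : Tendsto (fun t : ℝ => p * (1 - p) * ((t - 1) ^ 2 * t ^ (p - 1) /
      ((t ^ p - 1) * (1 - t ^ (p - 1))))) (𝓝[>] 0)
      (𝓝 (p * (1 - p) * ((0 - 1) ^ 2 * 0 / ((0 - 1) * (1 - 0))))) := by
    refine Tendsto.const_mul _ (Tendsto.div (((h0.sub_const 1).pow 2).mul (hp _ (by linarith)))
      (((hp p (by linarith)).sub_const 1).mul ((hp _ (by linarith)).const_sub 1)) (by norm_num))
  simp only [mul_zero, zero_div] at hlim
  refine hlim.congr' ?_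
  filter_upwards [Ioo_mem_nhdsGT (zero_lt_one' ℝ)] with t ht
  have h1 : t ^ (p - 1) ≠ 0 := (Real.rpow_pos_of_pos ht.1 _).ne'
  rw [wydFunction, if_neg ht.2.ne, show 1 - p = -(p - 1) by ring, Real.rpow_neg ht.1.le]
  have e : (t ^ (p - 1))⁻¹ - 1 = (1 - t ^ (p - 1)) / t ^ (p - 1) := by field_simp
  rw [e, ← mul_div_assoc (t ^ p - 1), div_div_eq_mul_div]

/-- The scalar form of the trace formula; the powers of `y` cancel through `y = y ^ p * y ^ (1 -
p)`. -/
lemma morozovaChentsov_wydFunction_mul_sq {p x y : ℝ} (hx : 0 < x) (hy : 0 < y) :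
    morozovaChentsov (wydFunction p) x y * (x - y) ^ 2 =
      1 / (p * (1 - p)) * ((x ^ p - y ^ p) * (x ^ (1 - p) - y ^ (1 - p))) := by
  by_cases hxy : x = y
  · simp [hxy]
  have h1 : x * y⁻¹ ≠ 1 := by
    rw [← div_eq_mul_inv, Ne, div_eq_one_iff_eq hy.ne']
    exact hxy
  have e : y = y ^ p * y ^ (1 - p) := by
    rw [← Real.rpow_add hy, add_sub_cancel, Real.rpow_one]
  have hd : x - y ≠ 0 := sub_ne_zero.2 hxy
  have hyp : y ^ p ≠ 0 := (Real.rpow_pos_of_pos hy _).ne'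
  have hyq : y ^ (1 - p) ≠ 0 := (Real.rpow_pos_of_pos hy _).ne'
  rw [morozovaChentsov, one_div, mul_inv, wydFunction_inv h1, ← div_eq_mul_inv,
    Real.div_rpow hx.le hy.le, Real.div_rpow hx.le hy.le]
  have e1 : (x ^ p / y ^ p - 1) * (x ^ (1 - p) / y ^ (1 - p) - 1) =
      (x ^ p - y ^ p) * (x ^ (1 - p) - y ^ (1 - p)) / y := by
    rw [div_sub_one hyp, div_sub_one hyq, div_mul_div_comm, ← e]
  rw [e1, div_sub_one hy.ne']
  field_simp

lemma unboundedSkewInfo_wydFunction {n : ℕ} (p : ℝ) {ρ : Matrix (Fin n) (Fin n) ℂ} (hρ : ρ.PosDef)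
    (A : Matrix (Fin n) (Fin n) ℂ) : unboundedSkewInfo (wydFunction p) ρ A =
      ((-1 / (p * (1 - p)) : ℝ) : ℂ) *
        (⁅matrixPow ρ p, A.conjTranspose⁆ * ⁅matrixPow ρ (1 - p), A⁆).trace := by
  rw [unboundedSkewInfo, hρ.1.monotoneMetric_commutator, matrixPow, matrixPow,
    hρ.1.trace_lie_cfc_mul_lie_cfc, ← Complex.ofReal_mul, neg_div, neg_mul_neg, Finset.mul_sum]
  refine congrArg _ (Finset.sum_congr rfl fun i _ => ?_)
  rw [Finset.mul_sum]
  refine Finset.sum_congr rfl fun j _ => ?_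
  rw [← mul_assoc, morozovaChentsov_wydFunction_mul_sq (hρ.eigenvalues_pos i)
    (hρ.eigenvalues_pos j), mul_assoc]

lemma unboundedSkewInfo_im_eq_zero_and_re_nonneg {n : ℕ} {f : ℝ → ℝ} (hf : ∀ t, 0 < t → 0 < f t)
    {ρ : Matrix (Fin n) (Fin n) ℂ} (hρ : ρ.PosDef) (A : Matrix (Fin n) (Fin n) ℂ) :
    (unboundedSkewInfo f ρ A).im = 0 ∧ 0 ≤ (unboundedSkewInfo f ρ A).re := by
  rw [unboundedSkewInfo, hρ.1.monotoneMetric_commutator, Complex.ofReal_im, Complex.ofReal_re]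
  refine ⟨rfl, Finset.sum_nonneg fun i _ => Finset.sum_nonneg fun j _ => ?_⟩
  have hi := hρ.eigenvalues_pos i
  have hj := hρ.eigenvalues_pos j
  have := hf (hρ.1.eigenvalues i * (hρ.1.eigenvalues j)⁻¹) (by positivity)
  rw [morozovaChentsov]
  positivity

/-! ### Unboundedness on diagonal states. -/

/-- On the finite spectrum `f` agrees with its Lagrange interpolant, and polynomials act on a
diagonal matrix entry by entry. -/
lemma cfc_diagonal {n : ℕ} (f : ℝ → ℝ) (d : Fin n → ℝ) :
    cfc f (Matrix.diagonal fun i => (d i : ℂ)) = Matrix.diagonal fun i => (f (d i) : ℂ) := by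
  have hD : IsSelfAdjoint (Matrix.diagonal fun i => (d i : ℂ)) := by
    refine (Matrix.isHermitian_diagonal_of_self_adjoint _ ?_).isSelfAdjoint
    exact funext fun i => Complex.conj_ofReal _
  set s := Finset.univ.image d
  set P := Lagrange.interpolate s id f with hP
  have hPf : ∀ i, P.eval (d i) = f (d i) := fun i =>
    Lagrange.eval_interpolate_at_node f (Function.injective_id.injOn)
      (Finset.mem_image_of_mem d (Finset.mem_univ i))
  have hspec : (spectrum ℝ (Matrix.diagonal fun i => (d i : ℂ))).EqOn f P.eval := by
    intro x hx
    rw [← spectrum.algebraMap_mem_iff ℂ, spectrum_diagonal] at hx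
    obtain ⟨i, hi⟩ := hx
    have : d i = x := Complex.ofReal_injective hi
    rw [← this]
    exact (hPf i).symm
  have haev : ∀ Q : Polynomial ℝ, Polynomial.aeval (Matrix.diagonal fun i => (d i : ℂ)) Q =
      Matrix.diagonal fun i => ((Q.eval (d i) : ℝ) : ℂ) := by
    intro Q
    induction Q using Polynomial.induction_on' with
    | add p q hp hq => simp [hp, hq, Matrix.diagonal_add]
    | monomial k a =>
      rw [Polynomial.aeval_monomial, Matrix.diagonal_pow, Matrix.algebraMap_eq_diagonal,
        Matrix.diagonal_mul_diagonal]
      simp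
  rw [cfc_congr hspec, cfc_polynomial P _ hD, haev]
  simp [hPf]

lemma lie_diagonal_single_add_single {n : ℕ} (d : Fin n → ℂ) (k l : Fin n) :
    ⁅Matrix.diagonal d, Matrix.single k l (1 : ℂ) + Matrix.single l k 1⁆ =
      (d k - d l) • (Matrix.single k l (1 : ℂ) - Matrix.single l k 1) := by
  ext i j
  simp only [Ring.lie_def, Matrix.sub_apply, Matrix.diagonal_mul, Matrix.mul_diagonal,
    Matrix.add_apply, Matrix.smul_apply, Matrix.single_apply, smul_eq_mul]
  split_ifs with h1 h2 h2
  · obtain ⟨rfl, rfl⟩ := h1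
    simp only [h2.1]
    ring
  · obtain ⟨rfl, rfl⟩ := h1
    ring
  · obtain ⟨rfl, rfl⟩ := h2
    ring
  · ring

lemma jencovaRuskai_diagonal {n : ℕ} (p : ℝ) (d : Fin n → ℝ) {k l : Fin n} (hkl : k ≠ l) :
    jencovaRuskai p (Matrix.diagonal fun i => (d i : ℂ))
      (Matrix.single k l 1 + Matrix.single l k 1) =
      ((2 / (p * (1 - p)) * ((d k ^ p - d l ^ p) * (d k ^ (1 - p) - d l ^ (1 - p))) : ℝ) : ℂ) := by
  rw [jencovaRuskai, matrixPow, matrixPow, cfc_diagonal, cfc_diagonal,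
    lie_diagonal_single_add_single, lie_diagonal_single_add_single, Matrix.smul_mul,
    Matrix.mul_smul, Matrix.trace_smul, Matrix.trace_smul]
  have : ((Matrix.single k l (1 : ℂ) - Matrix.single l k 1) *
      (Matrix.single k l (1 : ℂ) - Matrix.single l k 1)).trace = -2 := by
    rw [Matrix.mul_sub, Matrix.sub_mul, Matrix.sub_mul, Matrix.single_mul_single_same,
      Matrix.single_mul_single_same, Matrix.single_mul_single_of_ne _ _ _ _ hkl.symm,
      Matrix.single_mul_single_of_ne _ _ _ _ hkl]
    simp
    norm_num
  rw [this]
  push_cast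
  simp only [smul_eq_mul]
  ring

/-- The `k`-th eigenvalue `x` tends to `0` and the others are equal. Then `x ^ (1 - p)` diverges,
while the remaining factor has a positive limit because `p (1 - p) < 0`. -/
lemma not_bddAbove_jencovaRuskai {p : ℝ} (hp1 : 1 < p) {n : ℕ} {k l : Fin n} (hkl : k ≠ l) :
    ¬ BddAbove ((fun ρ => (jencovaRuskai p ρ
      (Matrix.single k l 1 + Matrix.single l k 1)).re) '' stateManifold n) := by
  have hn : 1 < n := by
    have := Fintype.one_lt_card_iff.2 ⟨k, l, hkl⟩
    rwa [Fintype.card_fin] at this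
  have hn' : (0 : ℝ) < n - 1 := by
    have : (1 : ℝ) < n := by exact_mod_cast hn
    linarith
  -- The common value of the other `n - 1` eigenvalues, dictated by trace one.
  set y : ℝ → ℝ := fun x => (1 - x) / (n - 1) with hy
  have hid : Tendsto (fun t : ℝ => t) (𝓝[>] 0) (𝓝 0) := tendsto_id.mono_left nhdsWithin_le_nhds
  have hylim : Tendsto y (𝓝[>] 0) (𝓝 ((1 - 0) / (n - 1))) := (hid.const_sub 1).div_const _
  have hy0 : (0 : ℝ) < (1 - 0) / (n - 1) := by positivity
  have hypow : ∀ s : ℝ, Tendsto (fun x => y x ^ s) (𝓝[>] 0) (𝓝 (((1 - 0) / (n - 1)) ^ s)) :=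
    fun s => hylim.rpow_const (Or.inl hy0.ne')
  have hxp : Tendsto (fun t : ℝ => t ^ p) (𝓝[>] 0) (𝓝 0) := by
    have := (Real.continuousAt_rpow_const 0 p (Or.inr (by linarith))).tendsto
    rw [Real.zero_rpow (by linarith)] at this
    exact this.mono_left nhdsWithin_le_nhds
  have hxq : Tendsto (fun t : ℝ => t ^ (1 - p)) (𝓝[>] 0) atTop :=
    tendsto_rpow_neg_nhdsGT_zero (by linarith)
  have h1 : Tendsto (fun x => 2 / (p * (1 - p)) * (x ^ p - y x ^ p)) (𝓝[>] 0)
      (𝓝 (2 / (p * (1 - p)) * (0 - ((1 - 0) / (n - 1)) ^ p))) :=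
    (hxp.sub (hypow p)).const_mul _
  have hpos : 0 < 2 / (p * (1 - p)) * (0 - ((1 - 0) / ((n : ℝ) - 1)) ^ p) := by
    refine mul_pos_of_neg_of_neg (div_neg_of_pos_of_neg two_pos (by nlinarith)) ?_
    rw [zero_sub, neg_lt_zero]
    exact Real.rpow_pos_of_pos hy0 _
  have h2 : Tendsto (fun x => x ^ (1 - p) - y x ^ (1 - p)) (𝓝[>] 0) atTop := by
    simp only [sub_eq_add_neg (_ ^ (1 - p) : ℝ)]
    exact hxq.atTop_add (hypow (1 - p)).neg
  have hlim := h1.pos_mul_atTop hpos h2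
  rintro ⟨M, hM⟩
  obtain ⟨x, hxM, hx0, hx1⟩ := ((hlim.eventually_gt_atTop M).and
    (Ioo_mem_nhdsGT (zero_lt_one' ℝ))).exists
  have hyx : 0 < y x := div_pos (by linarith) hn'
  set d : Fin n → ℝ := fun i => if i = k then x else y x with hd
  have hmem : (Matrix.diagonal fun i => (d i : ℂ)) ∈ stateManifold n := by
    refine ⟨Matrix.PosDef.diagonal fun i => ?_, ?_⟩
    · have : 0 < d i := by
        simp only [hd]
        split_ifs <;> assumption
      exact_mod_cast this
    · rw [Matrix.trace_diagonal, ← Complex.ofReal_sum]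
      have : ∑ i, d i = 1 := by
        have e : ∀ i, d i = y x + if i = k then x - y x else 0 := fun i => by
          simp only [hd]
          split_ifs <;> ring
        simp only [e, Finset.sum_add_distrib, Finset.sum_ite_eq', Finset.mem_univ, if_true,
          Finset.sum_const, Finset.card_univ, Fintype.card_fin, nsmul_eq_mul, hy]
        field_simp
        ring
      rw [this, Complex.ofReal_one]
  have hle := hM (mem_image_of_mem _ hmem)
  rw [jencovaRuskai_diagonal p d hkl, Complex.ofReal_re] at hle
  simp only [hd, if_true, if_neg hkl.symm] at hle
  rw [mul_assoc] at hxM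
  linarith

theorem mainTheorem4 (p : ℝ) (hp1 : 1 < p) (hp2 : p ≤ 2) :
    -- `f_p` is a non-regular function in `F_op`
    IsFop (wydFunction p) ∧ IsNonRegular (wydFunction p) ∧
    -- the extension is the metric adjusted skew information of `f_p`, for every observable
    (∀ (n : ℕ) (ρ A : Matrix (Fin n) (Fin n) ℂ), ρ ∈ stateManifold n → A.IsHermitian →
      unboundedSkewInfo (wydFunction p) ρ A = jencovaRuskai p ρ A) ∧
    -- the same trace formula for arbitrary matrices, with an adjoint in the first commutator
    (∀ (n : ℕ) (ρ A : Matrix (Fin n) (Fin n) ℂ), ρ ∈ stateManifold n →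
      unboundedSkewInfo (wydFunction p) ρ A =
        ((-1 / (p * (1 - p)) : ℝ) : ℂ) *
          (⁅matrixPow ρ p, A.conjTranspose⁆ * ⁅matrixPow ρ (1 - p), A⁆).trace) ∧
    -- it is real, non-negative and convex in the state, for arbitrary matrices
    (∀ (n : ℕ) (ρ A : Matrix (Fin n) (Fin n) ℂ), ρ ∈ stateManifold n →
      (unboundedSkewInfo (wydFunction p) ρ A).im = 0 ∧
        0 ≤ (unboundedSkewInfo (wydFunction p) ρ A).re) ∧
    (∀ (n : ℕ) (A : Matrix (Fin n) (Fin n) ℂ),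
      ConvexOn ℝ (stateManifold n) fun ρ => (unboundedSkewInfo (wydFunction p) ρ A).re) ∧
    -- hence so is the extension, for observables
    (∀ (n : ℕ) (ρ A : Matrix (Fin n) (Fin n) ℂ), ρ ∈ stateManifold n → A.IsHermitian →
      (jencovaRuskai p ρ A).im = 0 ∧ 0 ≤ (jencovaRuskai p ρ A).re) ∧
    (∀ (n : ℕ) (A : Matrix (Fin n) (Fin n) ℂ), A.IsHermitian →
      ConvexOn ℝ (stateManifold n) fun ρ => (jencovaRuskai p ρ A).re) ∧
    -- it is unbounded on the state manifold
    (∀ n : ℕ, 2 ≤ n → ∃ A : Matrix (Fin n) (Fin n) ℂ, A.IsHermitian ∧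
      ¬ BddAbove ((fun ρ => (jencovaRuskai p ρ A).re) '' stateManifold n)) := by
  obtain ⟨μ, hfin, hμ, hfμ⟩ := exists_measure_wydFunction_inv hp1 hp2
  have hpos : ∀ t, 0 < t → 0 < wydFunction p t := fun t ht => wydFunction_pos hp1 ht
  have hJR : ∀ (n : ℕ) (ρ A : Matrix (Fin n) (Fin n) ℂ), ρ ∈ stateManifold n → A.IsHermitian →
      unboundedSkewInfo (wydFunction p) ρ A = jencovaRuskai p ρ A := fun n ρ A hρ hA => by
    rw [unboundedSkewInfo_wydFunction p hρ.1, hA.eq, jencovaRuskai]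
  refine ⟨⟨hpos, isOperatorMonotone_of_inv_eq_integral hpos hμ hfμ,
      fun t ht => wydFunction_symmetric ht, if_pos rfl⟩, isNonRegular_wydFunction hp1, hJR,
    fun n ρ A hρ => unboundedSkewInfo_wydFunction p hρ.1 A,
    fun n ρ A hρ => unboundedSkewInfo_im_eq_zero_and_re_nonneg hpos hρ.1 A,
    fun n A => convexOn_unboundedSkewInfo hμ hfμ A, fun n ρ A hρ hA => ?_, fun n A hA => ?_,
    fun n hn => ?_⟩
  · rw [← hJR n ρ A hρ hA]
    exact unboundedSkewInfo_im_eq_zero_and_re_nonneg hpos hρ.1 A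
  · refine (convexOn_unboundedSkewInfo hμ hfμ A).congr fun ρ hρ => ?_
    simp only [hJR n ρ A hρ hA]
  · obtain ⟨k, l, hkl⟩ : ∃ k l : Fin n, k ≠ l :=
      Fintype.one_lt_card_iff.1 (by rwa [Fintype.card_fin])
    refine ⟨Matrix.single k l 1 + Matrix.single l k 1, ?_, not_bddAbove_jencovaRuskai hp1 hkl⟩
    rw [Matrix.IsHermitian, Matrix.conjTranspose_add, Matrix.conjTranspose_single,
      Matrix.conjTranspose_single, star_one, add_comm]
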